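/- Let $p$ be a prime, $r\ge 1$, and $R=\mathbb{Z}_{p^r}=\mathbb{Z}/p^r\mathbb{Z}$. A free convolutional code of length $n$ and rank $k$ over $R$ is a submodule $\mathcal{C}\subseteq R((D))^n$ of the form $$\mathcal{C}=\{u(D)G(D) : u(D)\in R((D))^k\},$$ where $G(D)\in R[D]^{k\times n}$ is a polynomial matrix of full rank, i.e. its rows are linearly independent over $R((D))$; every such $G(D)$ is called an encoder of $\mathcal{C}$. The weight $\mathrm{wt}[u(D)]\in\mathbb{N}\cup\{\infty\}$ of a vector of Laurent series is the total number of nonzero coefficients of its components. An encoder $G(D)$ is non-catastrophic if for all $u(D)\in R((D))^k$ $$\mathrm{wt}[u(D)G(D)]<\infty\iff \mathrm{wt}[u(D)]<\infty,$$ and catastrophic otherwise. A free convolutional code is called catastrophic if every encoder of it is catastrophic. The dual of $\mathcal{C}$ is $$\mathcal{C}^\perp=\{v(D)\in R((D))^n : v(D)\,w(D)^T=0 \text{ for all } w(D)\in\mathcal{C}\}.$$ Let $\mathcal{C}$ be a free convolutional code of length $n$ and rank $k$ over $\mathbb{Z}_{p^r}$. Then $\mathcal{C}^\perp$ is a free convolutional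 code of length $n$ and rank $n-k$, and $\mathcal{C}$ is catastrophic if and only if $\mathcal{C}^\perp$ is catastrophic. -/

import Mathlib

open Polynomial
open scoped LaurentSeries PowerSeries Matrix

noncomputable section

namespace ConvCode

variable {R : Type*} [CommRing R] {k n : ℕ}

/-- A polynomial matrix in the delay variable `D`, regarded as a matrix of Laurent series. -/
def laurentMatrix (G : Matrix (Fin k) (Fin n) R[X]) : Matrix (Fin k) (Fin n) R⸨X⸩ :=
  G.map fun f => ((f : R⟦X⟧) : R⸨X⸩)

/-- The Hamming weight of a vector of Laurent series: the total number of nonzero coefficients of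
its components, an element of `ℕ ∪ {∞}`. -/
def wt {m : ℕ} (u : Fin m → R⸨X⸩) : ℕ∞ :=
  ∑ i, {j : ℤ | (u i).coeff j ≠ 0}.encard

/-- The polynomial matrix `G` is a generator matrix (encoder) of `C`: it has full rank, i.e. its
rows are linearly independent over the ring of Laurent series, and `C` is the set of all
`u(D) G(D)`, where `u(D)` is a row vector of Laurent series. -/
def IsEncoder (G : Matrix (Fin k) (Fin n) R[X]) (C : Submodule R⸨X⸩ (Fin n → R⸨X⸩)) : Prop :=
  LinearIndependent R⸨X⸩ (fun i => laurentMatrix G i) ∧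
    ∀ v : Fin n → R⸨X⸩, v ∈ C ↔ ∃ u : Fin k → R⸨X⸩, v = u ᵥ* laurentMatrix G

/-- `C` is a free convolutional code of length `n` and rank `k`. -/
def IsFreeCode (k : ℕ) (C : Submodule R⸨X⸩ (Fin n → R⸨X⸩)) : Prop :=
  ∃ G : Matrix (Fin k) (Fin n) R[X], IsEncoder G C

/-- The encoder `G` is non-catastrophic: `u G` has finite weight exactly when `u` has. -/
def IsNoncatastrophicEncoder (G : Matrix (Fin k) (Fin n) R[X]) : Prop :=
  ∀ u : Fin k → R⸨X⸩, wt (u ᵥ* laurentMatrix G) < ⊤ ↔ wt u < ⊤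

/-- A code is catastrophic if all its encoders are catastrophic. -/
def IsCatastrophic (C : Submodule R⸨X⸩ (Fin n → R⸨X⸩)) : Prop :=
  ∀ (k : ℕ) (G : Matrix (Fin k) (Fin n) R[X]), IsEncoder G C → ¬ IsNoncatastrophicEncoder G

/-- The dual code: all vectors of Laurent series that are orthogonal to every codeword. -/
def dual (C : Submodule R⸨X⸩ (Fin n → R⸨X⸩)) : Submodule R⸨X⸩ (Fin n → R⸨X⸩) where
  carrier := {v | ∀ w ∈ C, v ⬝ᵥ w = 0}
  add_mem' := by
    intro a b ha hb w hw
    rw [add_dotProduct, ha w hw, hb w hw, add_zero]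
  zero_mem' := by
    intro w _
    exact zero_dotProduct w
  smul_mem' := by
    intro c a ha w hw
    rw [smul_dotProduct, ha w hw, smul_zero]

end ConvCode

end

/-!
Reduce an encoder `G` modulo the maximal ideal `𝔪` of `R`. The reduced matrix still has full rank,
and over the principal ideal domain `(R/𝔪)[D]` the Smith normal form of its row module completes it
to a square matrix of nonzero determinant; if `G` is non-catastrophic, the row module is saturated
up to powers of `D`, and then the determinant divides a power of `D`. Lift the completion to `R[D]`
and let `d` be its determinant. As `𝔪` is nilpotent, `d` is a unit of `R((D))`, respectively a
divisor of a power of `D`. Half of the adjugate of the lifted matrix is a parity-check matrix `H`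
of `G` up to the factor `d`, and it is an encoder of the dual code. The relation between `G` and `H`
is symmetric, and if `d` divides a power of `D` it forces both matrices to be non-catastrophic. So a
non-catastrophic code has a non-catastrophic dual, and the converse follows since a code is its own
double dual.
-/

noncomputable section

namespace ConvCode

open Matrix

section RowModule

variable {P ι κ μ ν : Type*} [CommRing P] [Fintype κ]

theorem range_vecMulLinear_le_range_fromRows [Fintype μ] (g : Matrix κ ν P) (h : Matrix μ ν P) :
    LinearMap.range g.vecMulLinear ≤ LinearMap.range (fromRows g h).vecMulLinear := by
  rintro _ ⟨y, rfl⟩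
  exact ⟨Sum.elim y 0, by simp [vecMul_fromRows]⟩

variable [Fintype ν] [DecidableEq ν]

theorem exists_det_dvd_of_smul_basis_mem_range [Fintype ι] (b : Module.Basis ν P (ν → P))
    (W : Matrix ι ν P) (e : ν ≃ ι) (M : Submonoid P)
    (h : ∀ j, ∃ c ∈ M, c • b j ∈ LinearMap.range W.vecMulLinear) :
    ∃ c ∈ M, (W.submatrix e id).det ∣ c := by
  choose c hcM A hA using h
  let B : Matrix ν ν P := of fun j => b j
  have hB : IsUnit B.det := by
    simpa only [Pi.basisFun_det_apply] using (Pi.basisFun P ν).isUnit_det b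
  have hAW : (of A).submatrix id e * W.submatrix e id = diagonal c * B := by
    rw [submatrix_mul_equiv, submatrix_id_id]
    ext i j
    rw [diagonal_mul]
    exact congrFun (hA i) j
  refine ⟨∏ j, c j, prod_mem fun j _ => hcM j, hB.dvd_mul_right.1 ?_⟩
  rw [← det_diagonal, ← det_mul, ← hAW, det_mul]
  exact dvd_mul_left _ _

theorem exists_fromRows_det_dvd [IsDomain P] [IsPrincipalIdealRing P] {g : Matrix κ ν P}
    (hg : LinearIndependent P g.row) (M : Submonoid P)
    (hM : ∀ (x : ν → P) (d : P), d ≠ 0 → d • x ∈ LinearMap.range g.vecMulLinear →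
      ∃ c ∈ M, c • x ∈ LinearMap.range g.vecMulLinear) :
    ∃ (m : ℕ) (h : Matrix (Fin m) ν P) (e : ν ≃ κ ⊕ Fin m),
      ∃ c ∈ M, ((fromRows g h).submatrix e id).det ∣ c := by
  classical
  obtain ⟨l, bM, bN, f, a, hsnf⟩ :=
    (LinearMap.range g.vecMulLinear).smithNormalForm (Pi.basisFun P ν)
  let rows : Module.Basis κ P (LinearMap.range g.vecMulLinear) :=
    (Pi.basisFun P κ).map (LinearEquiv.ofInjective _ (vecMul_injective_iff.2 hg))
  let rest := Fintype.equivFin {j // j ∉ Set.range f}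
  let e : κ ⊕ Fin _ ≃ ν :=
    (((rows.indexEquiv bN).trans (Equiv.ofInjective f f.injective)).sumCongr rest.symm).trans
      (Equiv.Set.sumCompl (Set.range f))
  refine ⟨_, of fun i => bM (rest.symm i), e.symm,
    exists_det_dvd_of_smul_basis_mem_range bM _ _ M fun j => ?_⟩
  by_cases hj : j ∈ Set.range f
  · obtain ⟨i, rfl⟩ := hj
    have ha : a i ≠ 0 := fun h => bN.ne_zero i (Subtype.ext (by rw [hsnf, h, zero_smul]; rfl))
    obtain ⟨c, hc, hcx⟩ := hM (bM (f i)) (a i) ha (hsnf i ▸ (bN i).2)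
    exact ⟨c, hc, range_vecMulLinear_le_range_fromRows g _ hcx⟩
  · refine ⟨1, one_mem M, Pi.single (Sum.inr (rest ⟨j, hj⟩)) 1, ?_⟩
    rw [vecMulLinear_apply, single_one_vecMul, one_smul]
    ext l
    simp

end RowModule

section ParityCheck

variable {A B κ μ ν : Type*} [CommRing A] [CommRing B]

theorem map_smul_one [DecidableEq κ] (f : A →+* B) (d : A) :
    (d • (1 : Matrix κ κ A)).map f = f d • (1 : Matrix κ κ B) := by
  rw [Matrix.map_smul' f d 1 (map_mul f), Matrix.map_one f (map_zero f) (map_one f)]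

theorem smul_one_eq_fromBlocks [DecidableEq κ] [DecidableEq μ] (d : A) :
    d • (1 : Matrix (κ ⊕ μ) (κ ⊕ μ) A) = fromBlocks (d • 1) 0 0 (d • 1) := by
  rw [← fromBlocks_one, fromBlocks_smul, smul_zero, smul_zero]

variable [Fintype κ] [DecidableEq κ] [Fintype μ] [DecidableEq μ] [Fintype ν] [DecidableEq ν]

/-- `H` is a parity-check matrix of `G` up to the factor `d`: for some `E` and `K`, the block
matrices `[G; K]` and `[E | Hᵀ]` are inverse to each other up to the scalar `d`. -/
def IsParityCheck (d : A) (G : Matrix κ ν A) (H : Matrix μ ν A) : Prop :=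
  ∃ (E : Matrix ν κ A) (K : Matrix μ ν A),
    G * E = d • 1 ∧ G * Hᵀ = 0 ∧ K * Hᵀ = d • 1 ∧ E * G + Hᵀ * K = d • 1

theorem exists_isParityCheck_det (G : Matrix κ ν A) (K : Matrix μ ν A) (e : ν ≃ κ ⊕ μ) :
    ∃ H : Matrix μ ν A, IsParityCheck ((fromRows G K).submatrix e id).det G H := by
  set W := (fromRows G K).submatrix e id with hW
  let V := W.adjugate.submatrix id e.symm
  have hGK : fromRows G K = W.submatrix e.symm id := by simp [hW]
  have hV : V = fromCols V.toCols₁ V.toCols₂ᵀᵀ := (fromCols_toCols V).symm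
  have hWV : fromRows G K * V = W.det • 1 := by
    rw [hGK, ← submatrix_mul _ _ _ _ _ Function.bijective_id, mul_adjugate]
    ext i j
    simp [one_apply]
  have hVW : V * fromRows G K = W.det • 1 := by
    rw [hGK, submatrix_mul_equiv, adjugate_mul, submatrix_id_id]
  rw [hV, fromRows_mul_fromCols, smul_one_eq_fromBlocks, fromBlocks_inj] at hWV
  rw [hV, fromCols_mul_fromRows] at hVW
  exact ⟨V.toCols₂ᵀ, V.toCols₁, K, hWV.1, hWV.2.1, hWV.2.2.2, hVW⟩

namespace IsParityCheck

variable {d : A} {G : Matrix κ ν A} {H : Matrix μ ν A}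

theorem symm (h : IsParityCheck d G H) : IsParityCheck d H G := by
  obtain ⟨E, K, hGE, hGH, hKH, hsum⟩ := h
  refine ⟨Kᵀ, Eᵀ, ?_, ?_, ?_, ?_⟩
  · simpa using congrArg transpose hKH
  · simpa using congrArg transpose hGH
  · simpa using congrArg transpose hGE
  · simpa [add_comm] using congrArg transpose hsum

theorem map (h : IsParityCheck d G H) (f : A →+* B) :
    IsParityCheck (f d) (G.map f) (H.map f) := by
  obtain ⟨E, K, hGE, hGH, hKH, hsum⟩ := h
  refine ⟨E.map f, K.map f, ?_, ?_, ?_, ?_⟩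
  · rw [← Matrix.map_mul, hGE, map_smul_one]
  · rw [← transpose_map, ← Matrix.map_mul, hGH, Matrix.map_zero f (map_zero f)]
  · rw [← transpose_map, ← Matrix.map_mul, hKH, map_smul_one]
  · rw [← transpose_map, ← Matrix.map_mul, ← Matrix.map_mul, ← Matrix.map_add f (map_add f), hsum,
      map_smul_one]

theorem linearIndependent_row (h : IsParityCheck d G H) (hd : IsUnit d) :
    LinearIndependent A G.row := by
  obtain ⟨E, -, hGE, -⟩ := h
  refine vecMul_injective_iff.1 fun u v huv => hd.smul_left_cancel.1 ?_
  simpa only [vecMul_vecMul, hGE, vecMul_smul, vecMul_one] using congrArg (· ᵥ* E) huv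

theorem mulVec_eq_zero_iff (h : IsParityCheck d G H) (hd : IsUnit d) (v : ν → A) :
    G *ᵥ v = 0 ↔ ∃ u, v = u ᵥ* H := by
  obtain ⟨E, K, -, hGH, -, hsum⟩ := h
  obtain ⟨c, hc⟩ := hd.exists_left_inv
  constructor
  · intro hv
    refine ⟨c • K *ᵥ v, ?_⟩
    calc v = c • (E * G + Hᵀ * K) *ᵥ v := by
          rw [hsum, smul_mulVec, one_mulVec, smul_smul, hc, one_smul]
      _ = (c • K *ᵥ v) ᵥ* H := by
          rw [add_mulVec, ← mulVec_mulVec, hv, mulVec_zero, zero_add, ← mulVec_mulVec,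
            mulVec_transpose, smul_vecMul]
  · rintro ⟨u, rfl⟩
    rw [← mulVec_transpose, mulVec_mulVec, hGH, zero_mulVec]

end IsParityCheck

end ParityCheck

section PolynomialMatrix

variable {R : Type*} [CommRing R] {k n : ℕ}

theorem laurentMatrix_eq_map_algebraMap (G : Matrix (Fin k) (Fin n) R[X]) :
    laurentMatrix G = G.map (algebraMap R[X] R⸨X⸩) := by
  ext1 i j
  exact (algebraMap_hahnSeries_apply ℤ (G i j)).symm

theorem algebraMap_comp_vecMul (u : Fin k → R[X]) (G : Matrix (Fin k) (Fin n) R[X]) :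
    algebraMap R[X] R⸨X⸩ ∘ (u ᵥ* G) = (algebraMap R[X] R⸨X⸩ ∘ u) ᵥ* laurentMatrix G := by
  rw [laurentMatrix_eq_map_algebraMap]
  exact funext fun j => RingHom.map_vecMul _ G u j

theorem algebraMap_comp_smul (c : R[X]) (x : Fin n → R[X]) :
    algebraMap R[X] R⸨X⸩ ∘ (c • x) = c • algebraMap R[X] R⸨X⸩ ∘ x :=
  funext fun i => (map_mul _ c (x i)).trans (Algebra.smul_def c _).symm

theorem linearIndependent_row_of_laurentMatrix {G : Matrix (Fin k) (Fin n) R[X]}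
    (hG : LinearIndependent R⸨X⸩ (laurentMatrix G).row) :
    LinearIndependent R[X] G.row := by
  have hinj : Function.Injective (algebraMap R[X] R⸨X⸩) := algebraMap_hahnSeries_injective ℤ
  refine vecMul_injective_iff.1 fun u v huv => hinj.comp_left (vecMul_injective_iff.2 hG ?_)
  dsimp only
  rw [← algebraMap_comp_vecMul, ← algebraMap_comp_vecMul, show u ᵥ* G = v ᵥ* G from huv]

end PolynomialMatrix

section FiniteWeight

variable {R : Type*} [CommRing R] {k n : ℕ}

theorem algebraMap_X_pow (j : ℕ) :
    algebraMap R[X] R⸨X⸩ (X ^ j) = HahnSeries.single (j : ℤ) 1 := by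
  simp

theorem single_neg_mul_algebraMap_X_pow (j : ℕ) :
    HahnSeries.single (-(j : ℤ)) (1 : R) * algebraMap R[X] R⸨X⸩ (X ^ j) = 1 := by
  rw [algebraMap_X_pow, HahnSeries.single_mul_single, neg_add_cancel, mul_one,
    HahnSeries.single_zero_one]

/-- The Laurent polynomials, that is, the Laurent series with finitely many nonzero coefficients. -/
def laurentPolynomials (R : Type*) [CommRing R] : Subalgebra R[X] R⸨X⸩ where
  carrier := {f | f.support.Finite}
  mul_mem' hf hg := (hf.add hg).subset HahnSeries.support_mul_subset
  add_mem' hf hg := (hf.union hg).subset (HahnSeries.support_add_subset _ _)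
  algebraMap_mem' f := by
    refine (f.support.finite_toSet.image (fun j : ℕ => (j : ℤ))).subset fun j hj => ?_
    rw [HahnSeries.mem_support, algebraMap_hahnSeries_apply, PowerSeries.coeff_coe] at hj
    split_ifs at hj with hj0
    · exact absurd rfl hj
    · exact ⟨j.natAbs, by simpa using hj, Int.natAbs_of_nonneg (not_lt.1 hj0)⟩

theorem wt_lt_top_iff {u : Fin n → R⸨X⸩} : wt u < ⊤ ↔ ∀ i, u i ∈ laurentPolynomials R := by
  refine (WithTop.sum_lt_top (M := ℕ)).trans ?_
  simp only [Finset.mem_univ, true_imp_iff]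
  exact forall_congr' fun i => Set.encard_lt_top_iff

theorem wt_vecMul_laurentMatrix_lt_top {u : Fin k → R⸨X⸩} (hu : wt u < ⊤)
    (G : Matrix (Fin k) (Fin n) R[X]) : wt (u ᵥ* laurentMatrix G) < ⊤ := by
  rw [wt_lt_top_iff] at hu ⊢
  rw [laurentMatrix_eq_map_algebraMap]
  exact fun j => sum_mem fun i _ => mul_mem (hu i) (Subalgebra.algebraMap_mem _ (G i j))

theorem exists_coe_eq_of_coe_mem_laurentPolynomials {g : R⟦X⟧}
    (hg : (g : R⸨X⸩) ∈ laurentPolynomials R) : ∃ w : R[X], (w : R⟦X⟧) = g := by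
  have hfin : (Function.support fun j => PowerSeries.coeff j g).Finite :=
    (Set.Finite.preimage Nat.cast_injective.injOn hg).subset fun j hj => by
      simpa [LaurentSeries.coeff_coe_powerSeries] using hj
  refine ⟨∑ j ∈ hfin.toFinset, monomial j (PowerSeries.coeff j g), ?_⟩
  ext j
  simp only [Polynomial.coeff_coe, finsetSum_coeff, coeff_monomial, Finset.sum_ite_eq',
    Set.Finite.mem_toFinset, Function.mem_support, ite_eq_left_iff, not_not]
  exact Eq.symm

theorem exists_X_pow_smul_eq_algebraMap_comp {u : Fin n → R⸨X⸩} (hu : wt u < ⊤) :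
    ∃ (j : ℕ) (w : Fin n → R[X]), (X ^ j : R[X]) • u = algebraMap R[X] R⸨X⸩ ∘ w := by
  rw [wt_lt_top_iff] at hu
  obtain ⟨⟨_, j, rfl⟩, hj⟩ := IsLocalization.exist_integer_multiples_of_finite
    (Submonoid.powers (PowerSeries.X : R⟦X⟧)) u
  choose g hg using hj
  have hg' : ∀ i, (g i : R⸨X⸩) = (X ^ j : R[X]) • u i := fun i => by
    rw [← LaurentSeries.coe_algebraMap, hg i, Algebra.smul_def, Algebra.smul_def]
    simp
  choose w hw using fun i => exists_coe_eq_of_coe_mem_laurentPolynomials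
    (hg' i ▸ Subalgebra.smul_mem _ (hu i) (X ^ j : R[X]))
  refine ⟨j, w, funext fun i => ?_⟩
  rw [Pi.smul_apply, ← hg', Function.comp_apply, algebraMap_hahnSeries_apply, hw]

variable {d : R[X]} {j : ℕ}

theorem isUnit_algebraMap_of_dvd_X_pow (hd : d ∣ X ^ j) : IsUnit (algebraMap R[X] R⸨X⸩ d) :=
  isUnit_of_dvd_unit (map_dvd (algebraMap R[X] R⸨X⸩) hd)
    (IsUnit.of_mul_eq_one_right _ (single_neg_mul_algebraMap_X_pow j))

theorem mem_laurentPolynomials_of_smul_mem (hd : d ∣ X ^ j) {f : R⸨X⸩}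
    (hf : d • f ∈ laurentPolynomials R) : f ∈ laurentPolynomials R := by
  obtain ⟨q, hq⟩ := hd
  have hX : f = HahnSeries.single (-(j : ℤ)) 1 * q • d • f := by
    rw [smul_smul, mul_comm q, ← hq, Algebra.smul_def, ← mul_assoc,
      single_neg_mul_algebraMap_X_pow, one_mul]
  rw [hX]
  exact mul_mem ((Set.finite_singleton _).subset HahnSeries.support_single_subset)
    (Subalgebra.smul_mem _ hf q)

end FiniteWeight

section Codes

variable {R : Type*} [CommRing R] {k m n : ℕ}

theorem IsEncoder.mem_dual_iff {C : Submodule R⸨X⸩ (Fin n → R⸨X⸩)}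
    {G : Matrix (Fin k) (Fin n) R[X]} (hG : IsEncoder G C) {v : Fin n → R⸨X⸩} :
    v ∈ dual C ↔ laurentMatrix G *ᵥ v = 0 := by
  constructor
  · intro hv
    ext1 i
    have hrow : laurentMatrix G i ∈ C := (hG.2 _).2 ⟨Pi.single i 1, (single_one_vecMul i _).symm⟩
    exact (dotProduct_comm _ _).trans (hv _ hrow)
  · intro hv w hw
    obtain ⟨u, rfl⟩ := (hG.2 w).1 hw
    rw [dotProduct_comm, ← dotProduct_mulVec, hv, dotProduct_zero]

theorem IsEncoder.unique {C C' : Submodule R⸨X⸩ (Fin n → R⸨X⸩)} {G : Matrix (Fin k) (Fin n) R[X]}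
    (hC : IsEncoder G C) (hC' : IsEncoder G C') : C = C' :=
  SetLike.ext fun v => (hC.2 v).trans (hC'.2 v).symm

namespace IsParityCheck

variable {d : R[X]} {G : Matrix (Fin k) (Fin n) R[X]} {H : Matrix (Fin m) (Fin n) R[X]}
  {C : Submodule R⸨X⸩ (Fin n → R⸨X⸩)}

theorem map_laurentMatrix (h : IsParityCheck d G H) :
    IsParityCheck (algebraMap R[X] R⸨X⸩ d) (laurentMatrix G) (laurentMatrix H) := by
  simpa only [laurentMatrix_eq_map_algebraMap] using h.map (algebraMap R[X] R⸨X⸩)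

theorem isEncoder_dual (h : IsParityCheck d G H) (hd : IsUnit (algebraMap R[X] R⸨X⸩ d))
    (hG : IsEncoder G C) : IsEncoder H (dual C) :=
  ⟨h.map_laurentMatrix.symm.linearIndependent_row hd,
    fun v => hG.mem_dual_iff.trans (h.map_laurentMatrix.mulVec_eq_zero_iff hd v)⟩

theorem dual_dual (h : IsParityCheck d G H) (hd : IsUnit (algebraMap R[X] R⸨X⸩ d))
    (hG : IsEncoder G C) : dual (dual C) = C :=
  (h.symm.isEncoder_dual hd (h.isEncoder_dual hd hG)).unique hG

theorem isNoncatastrophicEncoder {j : ℕ} (h : IsParityCheck d G H) (hd : d ∣ X ^ j) :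
    IsNoncatastrophicEncoder G := by
  refine fun u => ⟨fun hu => ?_, fun hu => wt_vecMul_laurentMatrix_lt_top hu G⟩
  obtain ⟨E, -, hGE, -⟩ := h
  have hdu : u ᵥ* laurentMatrix G ᵥ* laurentMatrix E = d • u := by
    rw [vecMul_vecMul, laurentMatrix_eq_map_algebraMap, laurentMatrix_eq_map_algebraMap,
      ← Matrix.map_mul, hGE, map_smul_one, vecMul_smul, vecMul_one, algebraMap_smul]
  have hfin := wt_vecMul_laurentMatrix_lt_top hu E
  rw [hdu, wt_lt_top_iff] at hfin
  exact wt_lt_top_iff.2 fun i => mem_laurentPolynomials_of_smul_mem hd (hfin i)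

end IsParityCheck

end Codes

section Reduction

theorem exists_dvd_pow_of_map_dvd_map {A B : Type*} [CommRing A] [CommRing B] {f : A →+* B}
    (hf : Function.Surjective f) (hker : ∀ a, f a = 0 → IsNilpotent a) {a b : A}
    (h : f a ∣ f b) : ∃ N, a ∣ b ^ N := by
  obtain ⟨c', hc'⟩ := h
  obtain ⟨c, rfl⟩ := hf c'
  obtain ⟨N, hN⟩ := hker (b - a * c) (by rw [map_sub, map_mul, hc', sub_self])
  refine ⟨N, (Dvd.intro c (sub_sub_cancel b (a * c)).symm).trans ?_⟩
  simpa only [hN, sub_zero] using sub_dvd_pow_sub_pow b (b - a * c) N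

variable {R S : Type*} [CommRing R] [CommRing S] {k n : ℕ}

theorem coeff_pow_mem_pow {Γ : Type*} [AddCommMonoid Γ] [PartialOrder Γ]
    [IsOrderedCancelAddMonoid Γ] {I : Ideal R} {f : HahnSeries Γ R} (hf : ∀ j, f.coeff j ∈ I)
    (N : ℕ) : ∀ j, (f ^ N).coeff j ∈ I ^ N := by
  induction N with
  | zero => simp
  | succ N ih =>
    intro j
    rw [pow_succ, pow_succ, HahnSeries.coeff_mul]
    exact sum_mem fun ij _ => Ideal.mul_mem_mul (ih ij.1) (hf ij.2)

theorem isNilpotent_of_forall_coeff_mem {Γ : Type*} [AddCommMonoid Γ] [PartialOrder Γ]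
    [IsOrderedCancelAddMonoid Γ] {I : Ideal R} (hI : IsNilpotent I) {f : HahnSeries Γ R}
    (hf : ∀ j, f.coeff j ∈ I) : IsNilpotent f := by
  obtain ⟨N, hN⟩ := hI
  refine ⟨N, HahnSeries.ext (funext fun j => ?_)⟩
  have hj := coeff_pow_mem_pow hf N j
  rwa [hN] at hj

/-- Coefficientwise application of a ring homomorphism to Laurent series. -/
def laurentMap (φ : R →+* S) : R⸨X⸩ →+* S⸨X⸩ where
  toFun f := f.map (φ : R →ₙ+* S)
  map_zero' := by ext; simp
  map_one' := by
    ext i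
    change φ (HahnSeries.coeff 1 i) = _
    rw [HahnSeries.coeff_one, HahnSeries.coeff_one, apply_ite φ, map_one, map_zero]
  map_add' f g := by ext j; exact map_add φ (f.coeff j) (g.coeff j)
  map_mul' f g := HahnSeries.map_mul (φ : R →ₙ+* S)

theorem coeff_laurentMap (φ : R →+* S) (f : R⸨X⸩) (j : ℤ) :
    (laurentMap φ f).coeff j = φ (f.coeff j) :=
  rfl

theorem laurentMap_algebraMap (φ : R →+* S) (f : R[X]) :
    laurentMap φ (algebraMap R[X] R⸨X⸩ f) = algebraMap S[X] S⸨X⸩ (mapRingHom φ f) := by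
  ext j
  rw [coeff_laurentMap, algebraMap_hahnSeries_apply, algebraMap_hahnSeries_apply,
    PowerSeries.coeff_coe, PowerSeries.coeff_coe]
  split_ifs <;> simp

theorem laurentMap_comp_vecMul (φ : R →+* S) (u : Fin k → R⸨X⸩) (G : Matrix (Fin k) (Fin n) R[X]) :
    laurentMap φ ∘ (u ᵥ* laurentMatrix G) =
      (laurentMap φ ∘ u) ᵥ* laurentMatrix (G.map (mapRingHom φ)) := by
  have hG : laurentMatrix (G.map (mapRingHom φ)) = (laurentMatrix G).map (laurentMap φ) := by
    ext1 i j
    simp only [laurentMatrix_eq_map_algebraMap, map_apply, laurentMap_algebraMap]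
  rw [hG]
  exact funext fun j => RingHom.map_vecMul _ _ u j

variable {φ : R →+* S}

theorem laurentMap_surjective (hφ : Function.Surjective φ) :
    Function.Surjective (laurentMap φ) := by
  classical
  intro f
  let lift : ZeroHom S R := ⟨fun a => if a = 0 then 0 else Function.surjInv hφ a, if_pos rfl⟩
  refine ⟨f.map lift, ?_⟩
  ext j
  rw [coeff_laurentMap, HahnSeries.map_coeff]
  change φ (if f.coeff j = 0 then 0 else _) = _
  split_ifs with h
  · rw [h, map_zero]
  · exact Function.surjInv_eq hφ _

-- If the annihilator of `s` is the kernel of `φ`, then `s • u` depends only on the reduction of `u`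
-- and has the same support, so statements about the reduction can be tested on `s • u`.
variable {s : R} (hs : ∀ a, s * a = 0 ↔ φ a = 0)

include hs

theorem support_C_smul (f : R⸨X⸩) :
    ((HahnSeries.C s : R⸨X⸩) • f).support = (laurentMap φ f).support := by
  ext j
  simp only [HahnSeries.mem_support, smul_eq_mul, HahnSeries.C_mul_eq_smul, HahnSeries.coeff_smul,
    coeff_laurentMap, ne_eq, hs]

theorem C_smul_eq_zero_iff (u : Fin n → R⸨X⸩) :
    (HahnSeries.C s : R⸨X⸩) • u = 0 ↔ laurentMap φ ∘ u = 0 := by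
  refine funext_iff.trans ((forall_congr' fun i => ?_).trans funext_iff.symm)
  exact HahnSeries.support_eq_empty_iff.symm.trans
    ((congrArg (· = ∅) (support_C_smul hs (u i))).to_iff.trans HahnSeries.support_eq_empty_iff)

theorem wt_C_smul (u : Fin n → R⸨X⸩) :
    wt ((HahnSeries.C s : R⸨X⸩) • u) = wt (laurentMap φ ∘ u) :=
  Finset.sum_congr rfl fun i _ => congrArg Set.encard (support_C_smul hs (u i))

variable (hφ : Function.Surjective φ) {G : Matrix (Fin k) (Fin n) R[X]}

include hφ

theorem linearIndependent_row_laurentMatrix_map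
    (hG : LinearIndependent R⸨X⸩ (laurentMatrix G).row) :
    LinearIndependent S⸨X⸩ (laurentMatrix (G.map (mapRingHom φ))).row := by
  refine vecMul_injective_iff.1 ((injective_iff_map_eq_zero (vecMulLinear _)).2 fun v hv => ?_)
  obtain ⟨u, rfl⟩ := (laurentMap_surjective hφ).comp_left v
  rw [vecMulLinear_apply, ← laurentMap_comp_vecMul, ← C_smul_eq_zero_iff hs, ← smul_vecMul] at hv
  exact (C_smul_eq_zero_iff hs u).1 (vecMul_injective_iff.2 hG (hv.trans (zero_vecMul _).symm))

theorem IsNoncatastrophicEncoder.map (hG : IsNoncatastrophicEncoder G) :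
    IsNoncatastrophicEncoder (G.map (mapRingHom φ)) := by
  intro v
  obtain ⟨u, rfl⟩ := (laurentMap_surjective hφ).comp_left v
  rw [← laurentMap_comp_vecMul, ← wt_C_smul hs, ← wt_C_smul hs, ← smul_vecMul]
  exact hG _

end Reduction

section Noncatastrophic

theorem IsNoncatastrophicEncoder.exists_X_pow_smul_mem_range {F : Type*} [Field F] {k n : ℕ}
    {G : Matrix (Fin k) (Fin n) F[X]} (hG : IsNoncatastrophicEncoder G) {x : Fin n → F[X]}
    {d : F[X]} (hd : d ≠ 0) (hx : d • x ∈ LinearMap.range G.vecMulLinear) :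
    ∃ j : ℕ, (X ^ j : F[X]) • x ∈ LinearMap.range G.vecMulLinear := by
  have hinj : Function.Injective (algebraMap F[X] F⸨X⸩) := algebraMap_hahnSeries_injective ℤ
  obtain ⟨a, ha⟩ := hx
  set u : Fin k → F⸨X⸩ := (algebraMap F[X] F⸨X⸩ d)⁻¹ • algebraMap F[X] F⸨X⸩ ∘ a with hu
  have huG : u ᵥ* laurentMatrix G = algebraMap F[X] F⸨X⸩ ∘ x := by
    rw [hu, smul_vecMul, ← algebraMap_comp_vecMul, show a ᵥ* G = d • x from ha,
      algebraMap_comp_smul, inv_smul_eq_iff₀ ((map_ne_zero_iff _ hinj).2 hd), algebraMap_smul]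
  have hfin : wt u < ⊤ := (hG u).1 (huG ▸ wt_lt_top_iff.2 fun i => Subalgebra.algebraMap_mem _ _)
  obtain ⟨j, w, hw⟩ := exists_X_pow_smul_eq_algebraMap_comp hfin
  refine ⟨j, w, hinj.comp_left ?_⟩
  rw [vecMulLinear_apply]
  calc algebraMap F[X] F⸨X⸩ ∘ (w ᵥ* G)
      = (X ^ j : F[X]) • u ᵥ* laurentMatrix G := by
        rw [algebraMap_comp_vecMul, ← hw, smul_vecMul]
    _ = algebraMap F[X] F⸨X⸩ ∘ ((X ^ j : F[X]) • x) := by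
        rw [huG, algebraMap_comp_smul]

end Noncatastrophic

section Lifting

theorem exists_isParityCheck_map_dvd {R F : Type*} [CommRing R] [Field F] {φ : R →+* F}
    (hφ : Function.Surjective φ) {k n : ℕ} {G : Matrix (Fin k) (Fin n) R[X]}
    (hG : LinearIndependent F[X] (G.map (mapRingHom φ)).row) (M : Submonoid F[X])
    (hM : ∀ (x : Fin n → F[X]) (d : F[X]), d ≠ 0 →
      d • x ∈ LinearMap.range (G.map (mapRingHom φ)).vecMulLinear →
      ∃ c ∈ M, c • x ∈ LinearMap.range (G.map (mapRingHom φ)).vecMulLinear) :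
    ∃ (m : ℕ) (d : R[X]) (H : Matrix (Fin m) (Fin n) R[X]),
      k + m = n ∧ IsParityCheck d G H ∧ ∃ c ∈ M, mapRingHom φ d ∣ c := by
  obtain ⟨m, h, e, c, hc, hdvd⟩ := exists_fromRows_det_dvd hG M hM
  have hlift : Function.Surjective (mapRingHom φ) := Polynomial.map_surjective φ hφ
  choose K hK using fun i j => hlift (h i j)
  obtain ⟨H, hH⟩ := exists_isParityCheck_det G (of K) e
  refine ⟨m, _, H, by simpa using (Fintype.card_congr e).symm, hH, c, hc, ?_⟩
  have hh : (of K).map (mapRingHom φ) = h := by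
    ext1 i j
    exact hK i j
  rwa [RingHom.map_det, RingHom.mapMatrix_apply, ← submatrix_map, fromRows_map, hh]

open IsLocalRing

variable {R : Type*} [CommRing R] [IsLocalRing R] {k n : ℕ}

theorem exists_mul_eq_zero_iff_residue_eq_zero (hR : IsNilpotent (maximalIdeal R)) :
    ∃ s : R, ∀ a, s * a = 0 ↔ residue R a = 0 := by
  obtain ⟨s, hs, hs0⟩ : ∃ s ∈ maximalIdeal R ^ (nilpotencyClass (maximalIdeal R) - 1), s ≠ 0 :=
    Submodule.exists_mem_ne_zero_of_ne_bot (pow_pred_nilpotencyClass hR)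
  refine ⟨s, fun a => ?_⟩
  rw [residue_eq_zero_iff]
  constructor
  · intro hsa
    by_contra ha
    exact hs0 ((notMem_maximalIdeal.1 ha).mul_left_eq_zero.1 hsa)
  · intro ha
    have hsa := Ideal.mul_mem_mul hs ha
    rwa [← pow_succ, Nat.sub_add_cancel (pos_nilpotencyClass_iff.2 hR), pow_nilpotencyClass hR]
      at hsa

theorem isNilpotent_of_mapRingHom_residue_eq_zero (hR : IsNilpotent (maximalIdeal R)) (f : R[X])
    (hf : mapRingHom (residue R) f = 0) : IsNilpotent f := by
  refine Polynomial.isNilpotent_iff.2 fun i => ?_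
  obtain ⟨N, hN⟩ := hR
  have hi : f.coeff i ∈ maximalIdeal R := by
    rw [← residue_eq_zero_iff, ← coeff_map, ← coe_mapRingHom, hf, coeff_zero]
  exact ⟨N, by simpa [hN] using Ideal.pow_mem_pow hi N⟩

theorem isNilpotent_of_laurentMap_residue_eq_zero (hR : IsNilpotent (maximalIdeal R)) (f : R⸨X⸩)
    (hf : laurentMap (residue R) f = 0) : IsNilpotent f := by
  refine isNilpotent_of_forall_coeff_mem hR fun j => ?_
  rw [← residue_eq_zero_iff, ← coeff_laurentMap, hf, HahnSeries.coeff_zero]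

theorem isUnit_of_isUnit_laurentMap_residue (hR : IsNilpotent (maximalIdeal R)) {f : R⸨X⸩}
    (hf : IsUnit (laurentMap (residue R) f)) : IsUnit f := by
  obtain ⟨N, hN⟩ := exists_dvd_pow_of_map_dvd_map (laurentMap_surjective residue_surjective)
    (isNilpotent_of_laurentMap_residue_eq_zero hR) (hf.dvd (a := laurentMap (residue R) 1))
  exact isUnit_of_dvd_one (by rwa [one_pow] at hN)

variable {C : Submodule R⸨X⸩ (Fin n → R⸨X⸩)} {G : Matrix (Fin k) (Fin n) R[X]}

theorem IsEncoder.linearIndependent_map_residue (hR : IsNilpotent (maximalIdeal R))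
    (hG : IsEncoder G C) :
    LinearIndependent (ResidueField R)[X] (G.map (mapRingHom (residue R))).row := by
  obtain ⟨s, hs⟩ := exists_mul_eq_zero_iff_residue_eq_zero hR
  exact linearIndependent_row_of_laurentMatrix
    (linearIndependent_row_laurentMatrix_map hs residue_surjective hG.1)

theorem IsEncoder.exists_isParityCheck_isUnit (hR : IsNilpotent (maximalIdeal R))
    (hG : IsEncoder G C) :
    ∃ (m : ℕ) (d : R[X]) (H : Matrix (Fin m) (Fin n) R[X]),
      k + m = n ∧ IsParityCheck d G H ∧ IsUnit (algebraMap R[X] R⸨X⸩ d) := by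
  obtain ⟨m, d, H, hkm, hH, c, hc, hdc⟩ :=
    exists_isParityCheck_map_dvd residue_surjective (hG.linearIndependent_map_residue hR)
      (nonZeroDivisors _) fun x d hd hx => ⟨d, mem_nonZeroDivisors_of_ne_zero hd, hx⟩
  refine ⟨m, d, H, hkm, hH, isUnit_of_isUnit_laurentMap_residue hR ?_⟩
  rw [laurentMap_algebraMap, isUnit_iff_ne_zero,
    map_ne_zero_iff _ (algebraMap_hahnSeries_injective ℤ)]
  exact ne_zero_of_dvd_ne_zero (nonZeroDivisors.ne_zero hc) hdc

theorem IsEncoder.exists_isParityCheck_dvd_X_pow (hR : IsNilpotent (maximalIdeal R))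
    (hG : IsEncoder G C) (hnoncat : IsNoncatastrophicEncoder G) :
    ∃ (m : ℕ) (d : R[X]) (H : Matrix (Fin m) (Fin n) R[X]) (j : ℕ),
      IsParityCheck d G H ∧ d ∣ X ^ j := by
  obtain ⟨s, hs⟩ := exists_mul_eq_zero_iff_residue_eq_zero hR
  obtain ⟨m, d, H, -, hH, _, ⟨j, rfl⟩, hdj⟩ :=
    exists_isParityCheck_map_dvd residue_surjective (hG.linearIndependent_map_residue hR)
      (Submonoid.powers X) fun x d hd hx =>
        let ⟨j, hj⟩ := (hnoncat.map hs residue_surjective).exists_X_pow_smul_mem_range hd hx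
        ⟨_, ⟨j, rfl⟩, hj⟩
  obtain ⟨N, hN⟩ := exists_dvd_pow_of_map_dvd_map (b := X ^ j)
    (Polynomial.map_surjective _ residue_surjective)
    (isNilpotent_of_mapRingHom_residue_eq_zero hR) (by simpa using hdj)
  exact ⟨m, d, H, j * N, hH, by rwa [pow_mul]⟩

theorem not_isCatastrophic_dual (hR : IsNilpotent (maximalIdeal R)) (hC : ¬ IsCatastrophic C) :
    ¬ IsCatastrophic (dual C) := by
  simp only [IsCatastrophic, not_forall, not_not] at hC ⊢
  obtain ⟨k, G, hG, hnoncat⟩ := hC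
  obtain ⟨m, d, H, j, hH, hd⟩ := hG.exists_isParityCheck_dvd_X_pow hR hnoncat
  exact ⟨m, H, hH.isEncoder_dual (isUnit_algebraMap_of_dvd_X_pow hd) hG,
    hH.symm.isNoncatastrophicEncoder hd⟩

theorem isLocalRing_zmod_prime_pow {p r : ℕ} (hp : p.Prime) (hr : 0 < r) :
    IsLocalRing (ZMod (p ^ r)) := by
  have : Fact p.Prime := ⟨hp⟩
  have : Fact (1 < p ^ r) := ⟨Nat.one_lt_pow hr.ne' hp.one_lt⟩
  exact IsLocalRing.of_surjective' (PadicInt.toZModPow r) (ZMod.ringHom_surjective _)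

theorem isNilpotent_maximalIdeal_zmod {N : ℕ} (hN : N ≠ 0) [IsLocalRing (ZMod N)] :
    IsNilpotent (maximalIdeal (ZMod N)) := by
  have : NeZero N := ⟨hN⟩
  exact (isArtinianRing_iff_isNilpotent_maximalIdeal _).1 inferInstance

end Lifting

end ConvCode

end

theorem mainTheorem5_general {R : Type*} [CommRing R] [IsLocalRing R]
    (hR : IsNilpotent (IsLocalRing.maximalIdeal R)) {n k : ℕ}
    {C : Submodule R⸨X⸩ (Fin n → R⸨X⸩)} (hC : ConvCode.IsFreeCode k C) :
    ConvCode.IsFreeCode (n - k) (ConvCode.dual C) ∧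
      (ConvCode.IsCatastrophic C ↔ ConvCode.IsCatastrophic (ConvCode.dual C)) := by
  obtain ⟨G, hG⟩ := hC
  obtain ⟨m, d, H, rfl, hH, hd⟩ := hG.exists_isParityCheck_isUnit hR
  have hdual := hH.isEncoder_dual hd hG
  refine ⟨by rw [Nat.add_sub_cancel_left]; exact ⟨H, hdual⟩, not_iff_not.1 ⟨?_, fun h => ?_⟩⟩
  · exact ConvCode.not_isCatastrophic_dual hR
  · simpa only [hH.dual_dual hd hG] using ConvCode.not_isCatastrophic_dual hR h

theorem mainTheorem5 (p r : ℕ) (hp : p.Prime) (hr : 0 < r) (n k : ℕ)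
    (C : Submodule (LaurentSeries (ZMod (p ^ r))) (Fin n → LaurentSeries (ZMod (p ^ r))))
    (hC : ConvCode.IsFreeCode k C) :
    ConvCode.IsFreeCode (n - k) (ConvCode.dual C) ∧
      (ConvCode.IsCatastrophic C ↔ ConvCode.IsCatastrophic (ConvCode.dual C)) := by
  have := ConvCode.isLocalRing_zmod_prime_pow hp hr
  exact mainTheorem5_general (ConvCode.isNilpotent_maximalIdeal_zmod (pow_ne_zero r hp.ne_zero)) hC
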